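/- Let $q$ be a prime power and let $\mathbb F_q$ be the field with $q$ elements. For an integer $n\ge 1$, an $n$-dimensional sequence over $\mathbb F_q$ is a map $s:\mathbb N_0^n\to\mathbb F_q$. A polynomial $P=\sum_{\mathbf j}a_{\mathbf j}\mathbf X^{\mathbf j}\in\mathbb F_q[X_1,\dots,X_n]$ acts on $s$ by $(Ps)(\mathbf m)=\sum_{\mathbf j}a_{\mathbf j}\,s(\mathbf m+\mathbf j)$. Let $I(s)=\{P: Ps=0\}$, and call $L(s)=\dim_{\mathbb F_q}\mathbb F_q[X_1,\dots,X_n]/I(s)$ the linear complexity of $s$. For positive integers $T_1,\dots,T_n$, the sequence $s$ is $(T_1,\dots,T_n)$-periodic if $X_i^{T_i}-1\in I(s)$ for $i=1,\dots,n$; there are $q^{T_1\cdots T_n}$ such sequences. For such $s$ and an integer $k\ge 0$, the $k$-error linear complexity $L_k(s)$ is the smallest linear complexity of a $(T_1,\dots,T_n)$-periodic sequence that differs from $s$ at no more than $k$ of the points $\mathbf m$ with $0\le m_i\le T_i-1$ $(1\le i\le n)$. **Theorem.** For every prime power $q$ and every $\varepsilon_1>0$ there is a number $\varepsilon_3=\varepsilon_3(\varepsilon_1,q)>0$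 such that for every integer $n\ge 2$ and every $\varepsilon_2>0$ there is a number $C=C(\varepsilon_1,\varepsilon_2,\varepsilon_3,n,q)$ with the following property. If positive integers $T_1,\dots,T_n$ satisfy $T_1\cdots T_n>C$ and a non-negative integer $k$ satisfies $k<\varepsilon_3T_1\cdots T_n$, then for $s$ chosen uniformly at random among the $(T_1,\dots,T_n)$-periodic sequences $\mathbb N_0^n\to\mathbb F_q$, $$\mathcal P\left(L_k(s)>\sqrt{\frac{(1-\varepsilon_1)\,T_1\cdots T_n}{n-1}}\right)>1-\varepsilon_2,$$ where the square root is read as $0$ if $\varepsilon_1>1$. -/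

import Mathlib

namespace MultiSeq

/-- An `n`-dimensional sequence over `F`: a map from `n`-tuples of natural numbers to `F`. -/
abbrev Seq (n : ℕ) (F : Type*) := (Fin n → ℕ) → F

/-- The action of a polynomial `P = ∑ a_j X^j` on a sequence `s`:
`(P s)(m) = ∑ a_j s(m + j)`. -/
def act {n : ℕ} {F : Type*} [Field F] (P : MvPolynomial (Fin n) F) (s : Seq n F) : Seq n F :=
  fun m => ∑ j ∈ P.support, P.coeff j * s (m + ⇑j)

theorem act_eq_sum {n : ℕ} {F : Type*} [Field F] (P : MvPolynomial (Fin n) F) (s : Seq n F)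
    (m : Fin n → ℕ) : act P s m = Finsupp.sum (AddMonoidAlgebra.coeff P)
      (fun j a => a * s (m + ⇑j)) := rfl

theorem act_add {n : ℕ} {F : Type*} [Field F] (P Q : MvPolynomial (Fin n) F) (s : Seq n F) :
    act (P + Q) s = act P s + act Q s := by
  funext m
  simp only [Pi.add_apply, act_eq_sum]
  exact Finsupp.sum_add_index' (by simp) (by intros; ring)

theorem act_monomial {n : ℕ} {F : Type*} [Field F] (j : Fin n →₀ ℕ) (a : F) (s : Seq n F)
    (m : Fin n → ℕ) : act (MvPolynomial.monomial j a) s m = a * s (m + ⇑j) := by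
  rw [act_eq_sum]
  exact Finsupp.sum_single_index (by simp)

theorem act_monomial_mul {n : ℕ} {F : Type*} [Field F] (i : Fin n →₀ ℕ) (a : F)
    (Q : MvPolynomial (Fin n) F) (s : Seq n F) (m : Fin n → ℕ) :
    act (MvPolynomial.monomial i a * Q) s m = a * act Q s (m + ⇑i) := by
  induction Q using MvPolynomial.induction_on' with
  | monomial j b =>
    rw [MvPolynomial.monomial_mul, act_monomial, act_monomial, Finsupp.coe_add, add_assoc, mul_assoc]
  | add P Q hP hQ => rw [mul_add, act_add, act_add, Pi.add_apply, Pi.add_apply, hP, hQ, mul_add]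

/-- The ideal `I(s)` of all polynomials `P` with `P s = 0` (the linear recurrences of `s`). -/
def annIdeal {n : ℕ} {F : Type*} [Field F] (s : Seq n F) : Ideal (MvPolynomial (Fin n) F) where
  carrier := {P | act P s = 0}
  zero_mem' := by
    funext m
    simp [act]
  add_mem' := by
    intro P Q hP hQ
    simp only [Set.mem_ofPred_eq] at hP hQ ⊢
    rw [act_add, hP, hQ, add_zero]
  smul_mem' := by
    intro P Q hQ
    simp only [Set.mem_ofPred_eq, smul_eq_mul] at hQ ⊢
    induction P using MvPolynomial.induction_on' with
    | monomial j b =>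
      funext m
      rw [act_monomial_mul, hQ]
      simp
    | add P R hP hR => rw [add_mul, act_add, hP, hR, add_zero]

/-- The linear complexity `L(s)`: the dimension over `F` of `F[X_1, …, X_n] / I(s)`.
It is used only for periodic sequences, where this dimension is finite. -/
noncomputable def linearComplexity {n : ℕ} {F : Type*} [Field F] (s : Seq n F) : ℕ :=
  Module.finrank F (MvPolynomial (Fin n) F ⧸ annIdeal s)

/-- `s` is periodic with period `(T_1, …, T_n)`: every `X_i ^ T_i - 1` lies in `I(s)`. -/
def IsPeriodic {n : ℕ} {F : Type*} [Field F] (T : Fin n → ℕ) (s : Seq n F) : Prop :=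
  ∀ i, (MvPolynomial.X i ^ T i - 1 : MvPolynomial (Fin n) F) ∈ annIdeal s

/-- The number of positions `m` with `0 ≤ m_i ≤ T_i - 1` for all `i` at which `s` and `σ`
differ. -/
noncomputable def periodDist {n : ℕ} {F : Type*} (T : Fin n → ℕ) (s σ : Seq n F) : ℕ :=
  Set.ncard {m : Fin n → ℕ | (∀ i, m i < T i) ∧ s m ≠ σ m}

/-- The `k`-error linear complexity `L_k(s)` of a `T`-periodic sequence `s`: the least linear
complexity of a `T`-periodic sequence that differs from `s` in at most `k` terms of a period. -/
noncomputable def kErrorLinearComplexity {n : ℕ} {F : Type*} [Field F] (T : Fin n → ℕ) (k : ℕ)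
    (s : Seq n F) : ℕ :=
  sInf {L : ℕ | ∃ σ : Seq n F, IsPeriodic T σ ∧ periodDist T s σ ≤ k ∧ linearComplexity σ = L}

/-- The probability of the event `E` for a sequence drawn uniformly at random from the (finite)
set of all `T`-periodic sequences over `F`. -/
noncomputable def periodicProb {n : ℕ} {F : Type*} [Field F] (T : Fin n → ℕ)
    (E : Seq n F → Prop) : ℝ :=
  (Set.ncard {s : Seq n F | IsPeriodic T s ∧ E s} : ℝ) /
    (Set.ncard {s : Seq n F | IsPeriodic T s} : ℝ)

end MultiSeq

/-! The proof counts. Let `N` be the product of the periods, so that there are `q ^ N` periodic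
sequences. A sequence of complexity `L` is recovered from the `L`-dimensional algebra `F[X] / I(s)`
and the functional `P ↦ (P s)(0)` on it. In a basis, multiplication by the variables has `n L`
columns of length `L`. A basis grown from `1` by multiplying by variables
(`exists_linearIndependent_tree`) makes `L - 1` of these columns unit vectors, so about `(n - 1) L ^
2` parameters remain instead of `n L ^ 2`; this is the source of `n - 1` in the theorem. The choice
of tree and the terms linear in `L` contribute only `exp (O(√N log N))`.

A sequence with `L_k ≤ K` is one of complexity at most `K` plus an error pattern of weight at most
`k`. With `(n - 1) K ^ 2 ≤ (1 - ε) N` and a Hamming ball of size at most `q ^ (ε N / 2)`, the bad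
sequences number at most `q ^ ((1 - ε / 2) N)` times a subexponential factor, a vanishing share of
`q ^ N`. -/

namespace MultiSeq

/-! ### Encoding a sequence by a multiplication table -/

section Encoding

variable {n : ℕ} {F : Type*} [Field F]

/-- The linear functional `P ↦ (P s)(0)`. -/
noncomputable def actZero (s : Seq n F) : MvPolynomial (Fin n) F →ₗ[F] F where
  toFun P := act P s 0
  map_add' P Q := by rw [act_add]; rfl
  map_smul' a P := by
    have h := act_monomial_mul 0 a P s 0
    rw [MvPolynomial.smul_eq_C_mul, MvPolynomial.C_apply, h]
    simp

theorem mem_annIdeal {s : Seq n F} {P : MvPolynomial (Fin n) F} :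
    P ∈ annIdeal s ↔ act P s = 0 := Iff.rfl

theorem actZero_monomial (s : Seq n F) (m : Fin n →₀ ℕ) :
    actZero s (MvPolynomial.monomial m 1) = s m := by
  change act _ s 0 = _
  rw [act_monomial]
  simp

/-- In a finite-dimensional algebra generated by `x`, a basis can be grown from `1` by
multiplying earlier members by the generators. -/
theorem exists_linearIndependent_tree {A : Type*} [CommRing A] [Algebra F A]
    [Module.Finite F A] (x : Fin n → A) (hx : Algebra.adjoin F (Set.range x) = ⊤) (d : ℕ)
    (hd : d + 1 ≤ Module.finrank F A) :
    ∃ (b : Fin (d + 1) → A) (τ : Fin d → Fin n × Fin (d + 1)), LinearIndependent F b ∧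
      b 0 = 1 ∧ ∀ j, b j.succ = b (τ j).2 * x (τ j).1 := by
  induction d with
  | zero =>
    have : Nontrivial A := Module.nontrivial_of_finrank_pos (R := F) (by omega)
    refine ⟨fun _ => 1, Fin.elim0, ?_, rfl, fun j => j.elim0⟩
    have : Subsingleton (Fin (0 + 1)) := inferInstanceAs (Subsingleton (Fin 1))
    exact LinearIndependent.of_subsingleton 0 one_ne_zero
  | succ d ih =>
    obtain ⟨b, τ, hb, hb0, hτ⟩ := ih (by omega)
    -- Otherwise the span is an ideal containing `1`, hence all of `A`, although its dimension `d +
    -- 1` is too small.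
    have key : ∃ i p, b p * x i ∉ Submodule.span F (Set.range b) := by
      by_contra! hcon
      have hclosed : ∀ i, ∀ w ∈ Submodule.span F (Set.range b),
          w * x i ∈ Submodule.span F (Set.range b) := by
        intro i w hw
        induction hw using Submodule.span_induction with
        | mem w hw => obtain ⟨p, rfl⟩ := hw; exact hcon i p
        | zero => simp
        | add u v _ _ hu hv => rw [add_mul]; exact Submodule.add_mem _ hu hv
        | smul a u _ hu => rw [smul_mul_assoc]; exact Submodule.smul_mem _ _ hu
      have hall : ∀ a : A, ∀ w ∈ Submodule.span F (Set.range b),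
          w * a ∈ Submodule.span F (Set.range b) := by
        intro a
        have ha : a ∈ Algebra.adjoin F (Set.range x) := hx ▸ Algebra.mem_top
        induction ha using Algebra.adjoin_induction with
        | mem a ha => obtain ⟨i, rfl⟩ := ha; exact hclosed i
        | algebraMap r =>
          intro w hw
          rw [mul_comm, ← Algebra.smul_def]
          exact Submodule.smul_mem _ _ hw
        | add u v _ _ hu hv =>
          intro w hw
          rw [mul_add]
          exact Submodule.add_mem _ (hu w hw) (hv w hw)
        | mul u v _ _ hu hv =>
          intro w hw
          rw [← mul_assoc]
          exact hv _ (hu w hw)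
      have htop : Submodule.span F (Set.range b) = ⊤ := by
        rw [eq_top_iff]
        intro a _
        have h1 : (1 : A) ∈ Submodule.span F (Set.range b) :=
          Submodule.subset_span ⟨0, hb0⟩
        simpa using hall a 1 h1
      have hcard := finrank_span_eq_card hb
      rw [htop, finrank_top, Fintype.card_fin] at hcard
      omega
    obtain ⟨i, p, hip⟩ := key
    refine ⟨Fin.snoc b (b p * x i),
      Fin.snoc (α := fun _ => Fin n × Fin (d + 1 + 1))
        (fun j => ((τ j).1, (τ j).2.castSucc)) (i, p.castSucc), ?_, ?_, ?_⟩
    · rw [linearIndependent_finSnoc]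
      exact ⟨hb, hip⟩
    · have h := Fin.snoc_castSucc (α := fun _ => A) (b p * x i) b 0
      rw [Fin.castSucc_zero] at h
      rw [h, hb0]
    · intro j
      induction j using Fin.lastCases with
      | last =>
        rw [Fin.succ_last, Fin.snoc_last, Fin.snoc_last, Fin.snoc_castSucc]
      | cast j =>
        rw [Fin.succ_castSucc, Fin.snoc_castSucc, Fin.snoc_castSucc, Fin.snoc_castSucc, hτ]

theorem adjoin_range_mk_X (I : Ideal (MvPolynomial (Fin n) F)) :
    Algebra.adjoin F (Set.range fun i => Ideal.Quotient.mk I (MvPolynomial.X i)) = ⊤ := by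
  have h := congrArg (Subalgebra.map (Ideal.Quotient.mkₐ F I))
    (MvPolynomial.adjoin_range_X (R := F) (σ := Fin n))
  rw [AlgHom.map_adjoin, ← Set.range_comp, Algebra.map_top,
    (AlgHom.range_eq_top _).2 (Ideal.Quotient.mkₐ_surjective F I)] at h
  exact h

/-- A sequence of linear complexity `d + 1` is described by a tree, a multiplication table which
is trivial on the tree, and `d + 1` initial values. -/
theorem exists_multiplication_table {d : ℕ} (s : Seq n F) (hs : linearComplexity s = d + 1) :
    ∃ (τ : Fin d ↪ Fin n × Fin (d + 1)) (M : Fin n × Fin (d + 1) → Fin (d + 1) → F)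
      (v : Fin (d + 1) → F) (c : MvPolynomial (Fin n) F →ₗ[F] (Fin (d + 1) → F)),
      (∀ j, M (τ j) = Pi.single j.succ 1) ∧ c 1 = Pi.single 0 1 ∧
      (∀ P i, c (P * MvPolynomial.X i) = ∑ p, c P p • M (i, p)) ∧
      ∀ m : Fin n →₀ ℕ, s m = ∑ j, c (MvPolynomial.monomial m 1) j * v j := by
  classical
  set I := annIdeal s with hI
  have hfin : Module.finrank F (MvPolynomial (Fin n) F ⧸ I) = d + 1 := hs
  have : Module.Finite F (MvPolynomial (Fin n) F ⧸ I) :=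
    Module.finite_of_finrank_pos (by omega)
  obtain ⟨b, τ, hb, hb0, hτ⟩ := exists_linearIndependent_tree _ (adjoin_range_mk_X I) d hfin.ge
  have hτinj : Function.Injective τ := by
    intro j j' h
    have h1 := hτ j
    rw [h, ← hτ j'] at h1
    exact Fin.succ_injective _ (hb.injective h1)
  let B := basisOfLinearIndependentOfCardEqFinrank hb (by simp [hfin])
  have hB : ∀ j, B j = b j := fun j => by simp [B]
  let π : MvPolynomial (Fin n) F →ₗ[F] (MvPolynomial (Fin n) F ⧸ I) :=
    (Ideal.Quotient.mkₐ F I).toLinearMap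
  have hπ : ∀ P, π P = Ideal.Quotient.mk I P := fun _ => rfl
  -- `P ↦ (P s)(0)` vanishes on `I`, so evaluating it through a linear section `g` does not depend
  -- on the section.
  obtain ⟨g, hg⟩ := π.exists_rightInverse_of_surjective
    (LinearMap.range_eq_top.2 (Ideal.Quotient.mkₐ_surjective F I))
  have hφ : ∀ P, actZero s (g (π P)) = actZero s P := by
    intro P
    have h1 : π (g (π P)) = π P := by
      have := LinearMap.congr_fun hg (π P)
      simpa using this
    rw [hπ, hπ, Ideal.Quotient.eq] at h1
    rw [← sub_eq_zero, ← map_sub]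
    exact congrFun (mem_annIdeal.1 h1) 0
  refine ⟨⟨τ, hτinj⟩, fun y => B.equivFun (b y.2 * Ideal.Quotient.mk I (MvPolynomial.X y.1)),
    fun j => actZero s (g (b j)), B.equivFun.toLinearMap ∘ₗ π, ?_, ?_, ?_, ?_⟩
  · intro j
    change B.equivFun (b (τ j).2 * Ideal.Quotient.mk I (MvPolynomial.X (τ j).1)) = _
    rw [← hτ j, ← hB]
    ext i
    rw [Module.Basis.equivFun_self, Pi.single_apply]
    simp only [eq_comm]
  · change B.equivFun (π 1) = _
    rw [hπ, map_one, ← hb0, ← hB]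
    ext i
    rw [Module.Basis.equivFun_self, Pi.single_apply]
    simp only [eq_comm]
  · intro P i
    change B.equivFun (π (P * _)) = ∑ p, B.equivFun (π P) p • B.equivFun _
    rw [hπ, map_mul, ← hπ P]
    conv_lhs => rw [← B.sum_equivFun (π P)]
    simp only [Finset.sum_mul, map_sum, smul_mul_assoc, map_smul, hB]
  · intro m
    rw [← actZero_monomial s m, ← hφ]
    change _ = ∑ j, B.equivFun (π _) j * _
    conv_lhs => rw [← B.sum_equivFun (π _)]
    simp only [map_sum, map_smul, hB, smul_eq_mul]

/-- The number of sequences of linear complexity `d + 1` is at most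
`(n (d + 1)) ^ d * q ^ ((d + 1) * (n (d + 1) - d) + (d + 1))`. -/
theorem ncard_linearComplexity_eq_succ_le [Fintype F] (d : ℕ) :
    {s : Seq n F | linearComplexity s = d + 1}.Finite ∧
    {s : Seq n F | linearComplexity s = d + 1}.ncard ≤
      (n * (d + 1)) ^ d *
        (Fintype.card F ^ ((d + 1) * (n * (d + 1) - d)) * Fintype.card F ^ (d + 1)) := by
  classical
  -- The table is stored only off the range of `τ`; on the range it is prescribed.
  let D := Σ τ : Fin d ↪ Fin n × Fin (d + 1),
    (({x // x ∉ Set.range τ} → Fin (d + 1) → F) × (Fin (d + 1) → F))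
  choose τ M v c h1 h2 h3 h4 using
    fun s : {s : Seq n F | linearComplexity s = d + 1} => exists_multiplication_table s.1 s.2
  let f : {s : Seq n F | linearComplexity s = d + 1} → D := fun s =>
    ⟨τ s, fun x => M s x, v s⟩
  have hf : Function.Injective f := by
    intro s s' h
    have hdata : τ s = τ s' ∧ v s = v s' ∧ M s = M s' := by
      have hτ : τ s = τ s' := congrArg Sigma.fst h
      have hsnd := (Sigma.mk.inj_iff.1 h).2
      refine ⟨hτ, ?_, ?_⟩
      · have : ∀ (t t' : Fin d ↪ Fin n × Fin (d + 1)) (_ : t = t')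
            (y : ({x // x ∉ Set.range t} → Fin (d + 1) → F) × (Fin (d + 1) → F))
            (y' : ({x // x ∉ Set.range t'} → Fin (d + 1) → F) × (Fin (d + 1) → F)),
            y ≍ y' → y.2 = y'.2 := by
          rintro t _ rfl y y' hy
          rw [eq_of_heq hy]
        exact this _ _ hτ _ _ hsnd
      · have : ∀ (t t' : Fin d ↪ Fin n × Fin (d + 1)) (_ : t = t')
            (y : ({x // x ∉ Set.range t} → Fin (d + 1) → F) × (Fin (d + 1) → F))
            (y' : ({x // x ∉ Set.range t'} → Fin (d + 1) → F) × (Fin (d + 1) → F)),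
            y ≍ y' → ∀ x (hx : x ∉ Set.range t) (hx' : x ∉ Set.range t'),
              y.1 ⟨x, hx⟩ = y'.1 ⟨x, hx'⟩ := by
          rintro t _ rfl y y' hy x hx hx'
          rw [eq_of_heq hy]
        funext x
        by_cases hx : x ∈ Set.range (τ s)
        · obtain ⟨j, rfl⟩ := hx
          rw [h1 s, hτ, h1 s']
        · exact this _ _ hτ _ _ hsnd x hx (hτ ▸ hx)
    obtain ⟨-, hv, hM⟩ := hdata
    -- The coordinates of every polynomial follow from those of `1` by repeated multiplication by
    -- variables, which the table governs.
    have hc : ∀ P, c s P = c s' P := by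
      intro P
      induction P using MvPolynomial.induction_on with
      | C a =>
        rw [← mul_one (MvPolynomial.C a), ← MvPolynomial.smul_eq_C_mul, map_smul, map_smul,
          h2 s, h2 s']
      | add P Q hP hQ => rw [map_add, map_add, hP, hQ]
      | mul_X P i hP => rw [h3 s, h3 s', hP, hM]
    refine Subtype.ext (funext fun m => ?_)
    have e := h4 s (Finsupp.equivFunOnFinite.symm m)
    have e' := h4 s' (Finsupp.equivFunOnFinite.symm m)
    rw [hc, hv, ← e'] at e
    simpa using e
  have hfinite : Finite {s : Seq n F | linearComplexity s = d + 1} := Finite.of_injective f hf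
  refine ⟨Set.toFinite _, ?_⟩
  rw [← Nat.card_coe_set_eq]
  refine (Nat.card_le_card_of_injective f hf).trans ?_
  rw [Nat.card_eq_fintype_card, Fintype.card_sigma]
  have hcard : ∀ t : Fin d ↪ Fin n × Fin (d + 1),
      Fintype.card (({x // x ∉ Set.range t} → Fin (d + 1) → F) × (Fin (d + 1) → F)) =
        Fintype.card F ^ ((d + 1) * (n * (d + 1) - d)) * Fintype.card F ^ (d + 1) := by
    intro t
    have : Fintype.card {x // x ∉ Set.range t} = n * (d + 1) - d := by
      rw [Fintype.card_subtype_compl, Fintype.card_prod, Fintype.card_fin, Fintype.card_fin]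
      congr 1
      rw [← Nat.card_eq_fintype_card]
      exact (Nat.card_range_of_injective t.injective).trans (by simp)
    rw [Fintype.card_prod, Fintype.card_fun, Fintype.card_fun, this, Fintype.card_fin, ← pow_mul]
  simp only [hcard]
  rw [Finset.sum_const, smul_eq_mul, Finset.card_univ]
  refine Nat.mul_le_mul_right _ ?_
  rw [Fintype.card_embedding_eq]
  refine (Nat.descFactorial_le_pow _ _).trans ?_
  simp

end Encoding

end MultiSeq

namespace MultiSeq

/-! ### Periodic sequences, and counting those of small complexity -/

section Periodic

variable {n : ℕ} {F : Type*} [Field F] {T : Fin n → ℕ}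

theorem act_X_pow_sub_one (i : Fin n) (t : ℕ) (s : Seq n F) (m : Fin n → ℕ) :
    act (MvPolynomial.X i ^ t - 1) s m = s (m + Pi.single i t) - s m := by
  have h := congrFun (act_add (MvPolynomial.X i ^ t - 1) 1 s) m
  rw [sub_add_cancel, Pi.add_apply, MvPolynomial.X_pow_eq_monomial, act_monomial] at h
  have h1 : act (1 : MvPolynomial (Fin n) F) s m = s m := by
    have := act_monomial 0 (1 : F) s m
    simpa using this
  rw [h1, one_mul] at h
  rw [MvPolynomial.X_pow_eq_monomial, ← Finsupp.single_eq_pi_single, h]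
  ring

theorem isPeriodic_iff {s : Seq n F} :
    IsPeriodic T s ↔ ∀ i m, s (m + Pi.single i (T i)) = s m := by
  refine forall_congr' fun i => ?_
  rw [mem_annIdeal]
  constructor
  · intro h m
    have := congrFun h m
    rw [act_X_pow_sub_one] at this
    exact sub_eq_zero.1 this
  · intro h
    funext m
    rw [act_X_pow_sub_one, h, sub_self]
    rfl

theorem IsPeriodic.apply_mod {s : Seq n F} (hs : IsPeriodic T s) (m : Fin n → ℕ) :
    s (fun i => m i % T i) = s m := by
  rw [isPeriodic_iff] at hs
  have hmul : ∀ i (a : ℕ) m, s (m + Pi.single i (a * T i)) = s m := by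
    intro i a
    induction a with
    | zero => simp
    | succ a ih =>
      intro m
      rw [Nat.succ_mul, Pi.single_add, ← add_assoc, hs, ih]
  have hsum : ∀ (S : Finset (Fin n)) m (a : Fin n → ℕ),
      s (m + ∑ i ∈ S, Pi.single i (a i * T i)) = s m := by
    intro S m a
    induction S using Finset.induction_on with
    | empty => simp
    | insert i S hi ih => rw [Finset.sum_insert hi, add_comm (Pi.single _ _), ← add_assoc, hmul, ih]
  have h := hsum Finset.univ (fun i => m i % T i) (fun i => m i / T i)
  rw [Finset.univ_sum_single] at h
  rw [← h]
  congr 1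
  funext i
  exact Nat.mod_add_div' (m i) (T i)

/-- Restriction of a sequence to one period. -/
def restrict (T : Fin n → ℕ) (s : Seq n F) : (∀ i, Fin (T i)) → F := fun m => s fun i => m i

theorem injOn_restrict (hT : ∀ i, 0 < T i) :
    Set.InjOn (restrict T) {s : Seq n F | IsPeriodic T s} := by
  intro s hs s' hs' h
  funext m
  rw [← IsPeriodic.apply_mod hs, ← IsPeriodic.apply_mod hs']
  exact congrFun h fun i => ⟨m i % T i, Nat.mod_lt _ (hT i)⟩

theorem image_restrict_isPeriodic (hT : ∀ i, 0 < T i) :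
    restrict T '' {s : Seq n F | IsPeriodic T s} = Set.univ := by
  rw [Set.eq_univ_iff_forall]
  intro f
  refine ⟨fun m => f fun i => ⟨m i % T i, Nat.mod_lt _ (hT i)⟩, ?_, ?_⟩
  · rw [Set.mem_ofPred_eq, isPeriodic_iff]
    intro i m
    congr 1
    funext j
    by_cases hj : j = i
    · subst hj; simp
    · simp [Pi.single_eq_of_ne hj]
  · funext m
    change f _ = f _
    congr 1
    funext i
    exact Fin.ext (Nat.mod_eq_of_lt (m i).2)

theorem finite_isPeriodic [Finite F] (hT : ∀ i, 0 < T i) :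
    {s : Seq n F | IsPeriodic T s}.Finite :=
  Set.Finite.of_finite_image (Set.toFinite _) (injOn_restrict hT)

theorem ncard_isPeriodic [Fintype F] (hT : ∀ i, 0 < T i) :
    {s : Seq n F | IsPeriodic T s}.ncard = Fintype.card F ^ ∏ i, T i := by
  rw [← (injOn_restrict hT).ncard_image, image_restrict_isPeriodic hT,
    Set.ncard_univ, Nat.card_eq_fintype_card]
  simp

/-- Each variable becomes a root of unity in the quotient, hence integral; a finitely generated
integral algebra is finite. -/
theorem finite_quotient_annIdeal (hT : ∀ i, 0 < T i) {s : Seq n F} (hs : IsPeriodic T s) :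
    Module.Finite F (MvPolynomial (Fin n) F ⧸ annIdeal s) := by
  have hint : Algebra.IsIntegral F (MvPolynomial (Fin n) F ⧸ annIdeal s) := by
    rw [Algebra.isIntegral_def]
    intro a
    have ha : a ∈ Algebra.adjoin F
        (Set.range fun i => Ideal.Quotient.mk (annIdeal s) (MvPolynomial.X i)) :=
      adjoin_range_mk_X (annIdeal s) ▸ Algebra.mem_top
    refine (Algebra.adjoin_le (S := integralClosure F _) ?_) ha
    rintro _ ⟨i, rfl⟩
    refine IsIntegral.of_pow (hT i) ?_
    have : Ideal.Quotient.mk (annIdeal s) (MvPolynomial.X i) ^ T i = 1 := by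
      rw [← map_pow, ← map_one (Ideal.Quotient.mk (annIdeal s)), Ideal.Quotient.eq]
      exact hs i
    rw [this]
    exact isIntegral_one
  exact Algebra.IsIntegral.finite

/-- Periodicity matters here: `finrank` is also `0` on an infinite-dimensional quotient. -/
theorem eq_zero_of_linearComplexity_eq_zero (hT : ∀ i, 0 < T i) {s : Seq n F}
    (hs : IsPeriodic T s) (h : linearComplexity s = 0) : s = 0 := by
  have := finite_quotient_annIdeal hT hs
  have hsub : Subsingleton (MvPolynomial (Fin n) F ⧸ annIdeal s) :=
    Module.finrank_zero_iff.1 h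
  have htop : annIdeal s = ⊤ := Ideal.Quotient.subsingleton_iff.1 hsub
  have h1 : (1 : MvPolynomial (Fin n) F) ∈ annIdeal s := htop ▸ Submodule.mem_top
  rw [mem_annIdeal] at h1
  funext m
  have h2 := act_monomial 0 (1 : F) s m
  have h3 : (MvPolynomial.monomial 0 (1 : F) : MvPolynomial (Fin n) F) = 1 := rfl
  rw [h3, h1] at h2
  simpa using h2.symm

/-- The number of periodic sequences of linear complexity at most `K`. -/
theorem ncard_linearComplexity_le [Fintype F] (hn : 1 ≤ n) (hT : ∀ i, 0 < T i) (K : ℕ) :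
    {s : Seq n F | IsPeriodic T s ∧ linearComplexity s ≤ K}.ncard ≤
      (n * (K + 1)) ^ (K + 1) * Fintype.card F ^ ((n - 1) * K ^ 2 + 2 * K) := by
  have hq : 0 < Fintype.card F := Fintype.card_pos
  have hsub : {s : Seq n F | IsPeriodic T s ∧ linearComplexity s ≤ K} ⊆
      ⋃ l ∈ Finset.range (K + 1), {s : Seq n F | IsPeriodic T s ∧ linearComplexity s = l} := by
    intro s hs
    simp only [Set.mem_iUnion, Finset.mem_range]
    exact ⟨linearComplexity s, Nat.lt_succ_of_le hs.2, hs.1, rfl⟩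
  have hfin : (⋃ l ∈ Finset.range (K + 1),
      {s : Seq n F | IsPeriodic T s ∧ linearComplexity s = l}).Finite :=
    (finite_isPeriodic hT).subset (by
      intro s hs
      simp only [Set.mem_iUnion] at hs
      obtain ⟨l, _, hs⟩ := hs
      exact hs.1)
  have hterm : ∀ l ∈ Finset.range (K + 1),
      {s : Seq n F | IsPeriodic T s ∧ linearComplexity s = l}.ncard ≤
        (n * (K + 1)) ^ K * Fintype.card F ^ ((n - 1) * K ^ 2 + 2 * K) := by
    intro l hl
    rw [Finset.mem_range, Nat.lt_succ_iff] at hl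
    have hbase : 1 ≤ n * (K + 1) := Nat.mul_pos hn (Nat.succ_pos K)
    rcases l with _ | d
    · have : {s : Seq n F | IsPeriodic T s ∧ linearComplexity s = 0} ⊆ {0} :=
        fun s hs => eq_zero_of_linearComplexity_eq_zero hT hs.1 hs.2
      refine (Set.ncard_le_ncard this).trans ?_
      rw [Set.ncard_singleton]
      exact Nat.mul_pos (pow_pos hbase _) (pow_pos hq _)
    · obtain ⟨hf, hc⟩ := ncard_linearComplexity_eq_succ_le (n := n) (F := F) d
      refine (Set.ncard_le_ncard (fun s hs => hs.2) hf).trans (hc.trans ?_)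
      refine Nat.mul_le_mul ?_ ?_
      · calc (n * (d + 1)) ^ d ≤ (n * (K + 1)) ^ d :=
              Nat.pow_le_pow_left (Nat.mul_le_mul_left _ (by omega)) _
          _ ≤ (n * (K + 1)) ^ K := Nat.pow_le_pow_right hbase (by omega)
      · rw [← pow_add]
        refine Nat.pow_le_pow_right hq ?_
        obtain ⟨e, rfl⟩ : ∃ e, n = e + 1 := ⟨n - 1, by omega⟩
        -- The number of free columns: the `d` tree edges lower the leading coefficient from `n` to
        -- `n - 1`.
        have h1 : (e + 1) * (d + 1) - d = e * (d + 1) + 1 := by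
          rw [add_mul]; omega
        rw [h1, Nat.add_sub_cancel]
        calc (d + 1) * (e * (d + 1) + 1) + (d + 1) = e * (d + 1) ^ 2 + 2 * (d + 1) := by ring
          _ ≤ e * K ^ 2 + 2 * K := by gcongr
  calc _ ≤ _ := Set.ncard_le_ncard hsub hfin
    _ ≤ ∑ l ∈ Finset.range (K + 1), _ := Finset.set_ncard_biUnion_le _ _
    _ ≤ ∑ l ∈ Finset.range (K + 1),
        (n * (K + 1)) ^ K * Fintype.card F ^ ((n - 1) * K ^ 2 + 2 * K) := Finset.sum_le_sum hterm
    _ = (K + 1) * (n * (K + 1)) ^ K * Fintype.card F ^ ((n - 1) * K ^ 2 + 2 * K) := by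
      rw [Finset.sum_const, Finset.card_range, smul_eq_mul, mul_assoc]
    _ ≤ _ := by
      refine Nat.mul_le_mul_right _ ?_
      rw [pow_succ']
      exact Nat.mul_le_mul_right _ (Nat.le_mul_of_pos_left _ hn)

/-! ### Hamming balls and error patterns -/

/-- Chernoff bound for the size of a Hamming ball. -/
theorem card_hammingBall_le {ι : Type*} [Fintype ι] [Fintype F] (k : ℕ) {z : ℝ}
    (hz0 : 0 < z) (hz1 : z ≤ 1) :
    ({f : ι → F | {m | f m ≠ 0}.ncard ≤ k}.ncard : ℝ) * z ^ k ≤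
      (1 + (Fintype.card F - 1) * z) ^ Fintype.card ι := by
  classical
  -- Weighting a pattern by `z` to its number of nonzero entries makes the total factor over
  -- positions, while each pattern in the ball weighs at least `z ^ k`.
  let w : F → ℝ := fun a => if a = 0 then 1 else z
  have hw : ∑ a, w a = 1 + (Fintype.card F - 1) * z := by
    rw [← Finset.add_sum_erase _ _ (Finset.mem_univ (0 : F))]
    rw [Finset.sum_congr rfl (g := fun _ => z) (fun a ha => by
      simp [w, Finset.ne_of_mem_erase ha])]
    rw [Finset.sum_const, Finset.card_erase_of_mem (Finset.mem_univ _), Finset.card_univ]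
    simp [w, Nat.cast_sub (Fintype.card_pos (α := F))]
  have hprod : ∀ f : ι → F, ∏ m, w (f m) = z ^ {m | f m ≠ 0}.ncard := by
    intro f
    simp only [w, Finset.prod_ite, Finset.prod_const_one, one_mul, Finset.prod_const]
    congr 1
    rw [Set.ncard_eq_toFinset_card']
    simp
  rw [← hw, ← Finset.card_univ, ← Finset.prod_const, Finset.prod_univ_sum,
    Fintype.piFinset_univ, Set.ncard_eq_toFinset_card', ← nsmul_eq_mul, ← Finset.sum_const]
  refine (Finset.sum_le_sum (g := fun f => ∏ m, w (f m)) fun f hf => ?_).trans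
    (Finset.sum_le_sum_of_subset_of_nonneg (Finset.subset_univ _) fun f _ _ => ?_)
  · rw [hprod]
    exact pow_le_pow_of_le_one hz0.le hz1 (by simpa using hf)
  · rw [hprod]; positivity

theorem periodDist_eq_ncard_restrict (s σ : Seq n F) :
    periodDist T s σ = {m | restrict T s m - restrict T σ m ≠ 0}.ncard := by
  have hinj : Function.Injective (fun (m : ∀ i, Fin (T i)) (i : Fin n) => (m i : ℕ)) := by
    intro m m' h
    funext i
    exact Fin.ext (congrFun h i)
  rw [periodDist, ← Set.ncard_image_of_injective _ hinj]
  congr 1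
  ext m
  constructor
  · rintro ⟨hm, hne⟩
    exact ⟨fun i => ⟨m i, hm i⟩, sub_ne_zero.2 hne, rfl⟩
  · rintro ⟨m, hne, rfl⟩
    exact ⟨fun i => (m i).2, sub_ne_zero.1 hne⟩

/-- Sequences of small `k`-error linear complexity lie close to sequences of small linear
complexity. -/
theorem ncard_kErrorLinearComplexity_le [Fintype F] (hT : ∀ i, 0 < T i) (k K : ℕ) :
    {s : Seq n F | IsPeriodic T s ∧ kErrorLinearComplexity T k s ≤ K}.ncard ≤
      {s : Seq n F | IsPeriodic T s ∧ linearComplexity s ≤ K}.ncard *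
        {f : (∀ i, Fin (T i)) → F | {m | f m ≠ 0}.ncard ≤ k}.ncard := by
  have hex : ∀ s : Seq n F, IsPeriodic T s → kErrorLinearComplexity T k s ≤ K →
      ∃ σ, (IsPeriodic T σ ∧ linearComplexity σ ≤ K) ∧ periodDist T s σ ≤ k := by
    intro s hs hK
    -- Nonemptiness, witnessed by `s` itself, ensures that the infimum is attained.
    have hne : {L : ℕ | ∃ σ : Seq n F, IsPeriodic T σ ∧ periodDist T s σ ≤ k ∧
        linearComplexity σ = L}.Nonempty :=
      ⟨linearComplexity s, s, hs, by simp [periodDist], rfl⟩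
    obtain ⟨σ, h1, h2, h3⟩ := Nat.sInf_mem hne
    exact ⟨σ, ⟨h1, h3.trans_le hK⟩, h2⟩
  choose! g hg hgk using hex
  rw [← Set.ncard_prod]
  refine Set.ncard_le_ncard_of_injOn (fun s => (g s, restrict T s - restrict T (g s))) ?_ ?_ ?_
  · rintro s ⟨hs, hK⟩
    refine ⟨hg s hs hK, ?_⟩
    have := hgk s hs hK
    rwa [periodDist_eq_ncard_restrict] at this
  · rintro s ⟨hs, hK⟩ s' ⟨hs', hK'⟩ h
    obtain ⟨h1, h2⟩ := Prod.mk.inj h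
    rw [h1] at h2
    exact injOn_restrict hT hs hs' (sub_left_injective h2)
  · exact ((finite_isPeriodic hT).subset fun s hs => hs.1).prod (Set.toFinite _)

end Periodic

end MultiSeq

/-! ### Asymptotic estimates -/

namespace MultiSeq

/-- Half of the exponent `δ` pays for `(1 + (q - 1) z) ^ N`, by taking `z` small, and half for `z ^
(-k)`, by taking `ρ` small. Only `q` and `δ` enter, so the final `ε₃` is independent of `n`. -/
theorem exists_chernoff_rate {q δ : ℝ} (hq : 1 < q) (hδ : 0 < δ) :
    ∃ ρ z : ℝ, 0 < ρ ∧ 0 < z ∧ z ≤ 1 ∧ ∀ N k : ℕ, (k : ℝ) < ρ * N →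
      (1 + (q - 1) * z) ^ N ≤ q ^ (δ * N) * z ^ k := by
  have hlogq : 0 < Real.log q := Real.log_pos hq
  have hpow : 1 < q ^ (δ / 2) := Real.one_lt_rpow hq (by positivity)
  have hq1 : 0 < q - 1 := by linarith
  set z := min 1 ((q ^ (δ / 2) - 1) / (q - 1)) with hz
  have hz0 : 0 < z := lt_min one_pos (div_pos (by linarith) hq1)
  have hz1 : z ≤ 1 := min_le_left _ _
  have hzq : 1 + (q - 1) * z ≤ q ^ (δ / 2) := by
    have h := mul_le_mul_of_nonneg_left
      (min_le_right 1 ((q ^ (δ / 2) - 1) / (q - 1))) hq1.le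
    rw [mul_div_cancel₀ _ hq1.ne', ← hz] at h
    linarith
  have hlz : 0 ≤ -Real.log z := neg_nonneg.2 (Real.log_nonpos hz0.le hz1)
  -- The `+ 1` keeps the denominator positive when `z = 1`.
  refine ⟨δ / 2 * Real.log q / (-Real.log z + 1), z, by positivity, hz0, hz1, fun N k hk => ?_⟩
  have hkz : (k : ℝ) * (-Real.log z) ≤ δ / 2 * Real.log q * N := by
    rw [div_mul_eq_mul_div, lt_div_iff₀ (by linarith)] at hk
    have : (0 : ℝ) ≤ k := Nat.cast_nonneg k
    nlinarith
  have hzk : z ^ k = Real.exp (k * Real.log z) := by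
    rw [← Real.rpow_natCast, Real.rpow_def_of_pos hz0, mul_comm]
  calc (1 + (q - 1) * z) ^ N ≤ (q ^ (δ / 2)) ^ N := pow_le_pow_left₀ (by positivity) hzq _
    _ = Real.exp (Real.log q * (δ / 2 * N)) := by
      rw [← Real.rpow_natCast, ← Real.rpow_mul (by linarith), Real.rpow_def_of_pos (by linarith)]
    _ ≤ Real.exp (Real.log q * (δ * N) + k * Real.log z) := by
      rw [Real.exp_le_exp]
      linarith
    _ = _ := by rw [Real.exp_add, hzk, Real.rpow_def_of_pos (by linarith)]

theorem tendsto_mul_log_sub_atBot (a : ℝ) {c : ℝ} (hc : 0 < c) :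
    Filter.Tendsto (fun y : ℝ => y * (Real.log y + a - c * y)) Filter.atTop Filter.atBot := by
  refine Filter.tendsto_id.atTop_mul_atBot₀ ?_
  have hsmall : ∀ᶠ y : ℝ in Filter.atTop, Real.log y ≤ c / 2 * y := by
    have h := Real.isLittleO_log_id_atTop.bound (half_pos hc)
    filter_upwards [h, Filter.eventually_ge_atTop 0] with y hy hy0
    rw [id, Real.norm_eq_abs, Real.norm_eq_abs, abs_of_nonneg hy0] at hy
    exact (le_abs_self _).trans hy
  have hlin : Filter.Tendsto (fun y : ℝ => a + -(c / 2) * y) Filter.atTop Filter.atBot :=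
    Filter.tendsto_atBot_add_const_left _ _
      (Filter.tendsto_id.const_mul_atTop_of_neg (by linarith))
  refine Filter.tendsto_atBot_mono' _ ?_ hlin
  filter_upwards [hsmall] with y hy
  linarith

/-- A quantity `exp (O(√N log N))` is eventually smaller than `q ^ (δ N)`. -/
theorem exists_forall_pow_mul_pow_lt {q δ ε : ℝ} (hq : 1 < q) (hδ : 0 < δ) (hε : 0 < ε) (n : ℕ)
    (hn : 1 ≤ n) : ∃ C : ℝ, ∀ N K : ℕ, C < N → K ^ 2 ≤ N →
      ((n : ℝ) * (K + 1)) ^ (K + 1) * q ^ (2 * K) < ε * q ^ (δ * N) := by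
  have hlogq : 0 < Real.log q := Real.log_pos hq
  have hn1 : (1 : ℝ) ≤ n := by exact_mod_cast hn
  -- Applied at `y = √N + 1 ≥ K + 1`. The term `2 * (δ * Real.log q)` compensates for the decay
  -- being in `N = (y - 1) ^ 2` rather than `y ^ 2`.
  have hlim := (tendsto_mul_log_sub_atBot
    (Real.log n + 2 * Real.log q + 2 * (δ * Real.log q)) (mul_pos hδ hlogq)).comp
    (Filter.tendsto_atTop_add_const_right _ (1 : ℝ) Real.tendsto_sqrt_atTop)
  obtain ⟨C, hC⟩ := Filter.eventually_atTop.1 (hlim.eventually_lt_atBot (Real.log ε))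
  refine ⟨C, fun N K hN hK => ?_⟩
  have hy := hC N hN.le
  simp only [Function.comp] at hy
  have hsq : Real.sqrt N ^ 2 = N := Real.sq_sqrt (Nat.cast_nonneg N)
  have hKy : (K : ℝ) ≤ Real.sqrt N := Real.le_sqrt_of_sq_le (by exact_mod_cast hK)
  have hx0 : 0 ≤ Real.sqrt N := Real.sqrt_nonneg _
  set x := Real.sqrt N
  have hK0 : (0 : ℝ) ≤ K := Nat.cast_nonneg K
  have hlogK : Real.log (n * (K + 1)) ≤ Real.log n + Real.log (x + 1) := by
    rw [Real.log_mul (by positivity) (by positivity)]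
    gcongr
  have hlogK0 : 0 ≤ Real.log (n * (K + 1)) := Real.log_nonneg (by nlinarith)
  rw [← Real.log_lt_log_iff (by positivity) (by positivity),
    Real.log_mul (by positivity) (by positivity), Real.log_mul (by positivity) (by positivity),
    Real.log_pow, Real.log_pow, Real.log_rpow (by linarith), ← hsq]
  push_cast
  have h1 : ((K : ℝ) + 1) * Real.log (n * (K + 1)) ≤
      (x + 1) * (Real.log n + Real.log (x + 1)) := by
    gcongr
  have h2 : 2 * (K : ℝ) * Real.log q ≤ 2 * (x + 1) * Real.log q := by
    gcongr
    linarith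
  have h3 : 0 < δ * Real.log q := mul_pos hδ hlogq
  nlinarith

/-! ### Assembling the bound -/

theorem exists_error_rate_of_le_one {q : ℕ} (hq : 1 < q) {ε : ℝ} (hε : 0 < ε) (hε1 : ε ≤ 1) :
    ∃ ε₃ : ℝ, 0 < ε₃ ∧ ∀ n : ℕ, 2 ≤ n → ∀ ε₂ : ℝ, 0 < ε₂ →
      ∃ C : ℝ, ∀ (F : Type*) [Field F] [Fintype F], Fintype.card F = q →
        ∀ T : Fin n → ℕ, (∀ i, 0 < T i) → C < ∏ i, (T i : ℝ) →
          ∀ k : ℕ, (k : ℝ) < ε₃ * ∏ i, (T i : ℝ) →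
            1 - ε₂ < periodicProb T (fun s : Seq n F =>
              Real.sqrt ((1 - ε) * (∏ i, (T i : ℝ)) / ((n : ℝ) - 1)) <
                (kErrorLinearComplexity T k s : ℝ)) := by
  have hqR : (1 : ℝ) < q := by exact_mod_cast hq
  -- The slack `ε` is split evenly between the Hamming ball and the subexponential factor.
  obtain ⟨ρ, z, hρ, hz0, hz1, hball⟩ := exists_chernoff_rate hqR (half_pos hε)
  refine ⟨ρ, hρ, fun n hn ε₂ hε₂ => ?_⟩
  obtain ⟨C, hC⟩ := exists_forall_pow_mul_pow_lt hqR (half_pos hε) hε₂ n (by omega)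
  refine ⟨C, fun F _ _ hF T hT hCT k hk => ?_⟩
  set N := ∏ i, T i with hN
  have hNR : ∏ i, (T i : ℝ) = N := by rw [hN, Nat.cast_prod]
  rw [hNR] at hCT hk ⊢
  set R := Real.sqrt ((1 - ε) * N / ((n : ℝ) - 1)) with hR
  set K := ⌊R⌋₊ with hKdef
  have hn1 : (1 : ℝ) ≤ (n : ℝ) - 1 := by
    have : (2 : ℝ) ≤ n := by exact_mod_cast hn
    linarith
  have hKR : (K : ℝ) ≤ R := Nat.floor_le (Real.sqrt_nonneg _)
  have hN0 : (0 : ℝ) ≤ N := Nat.cast_nonneg N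
  have hK2 : ((n : ℝ) - 1) * (K : ℝ) ^ 2 ≤ (1 - ε) * N := by
    have hR2 : R ^ 2 = (1 - ε) * N / ((n : ℝ) - 1) :=
      Real.sq_sqrt (div_nonneg (mul_nonneg (by linarith) hN0) (by linarith))
    have h : (K : ℝ) ^ 2 ≤ (1 - ε) * N / ((n : ℝ) - 1) :=
      hR2 ▸ pow_le_pow_left₀ (Nat.cast_nonneg K) hKR 2
    rw [le_div_iff₀ (by linarith)] at h
    linarith
  have hKN : K ^ 2 ≤ N := by
    have : (K : ℝ) ^ 2 ≤ N := by nlinarith [sq_nonneg (K : ℝ), mul_nonneg hε.le hN0]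
    exact_mod_cast this
  have hasym := hC N K hCT hKN
  set all := {s : Seq n F | IsPeriodic T s} with hall
  set good := {s : Seq n F | IsPeriodic T s ∧ R < (kErrorLinearComplexity T k s : ℝ)}
  set bad := {s : Seq n F | IsPeriodic T s ∧ kErrorLinearComplexity T k s ≤ K}
  have hallcard : (all.ncard : ℝ) = (q : ℝ) ^ N := by
    rw [hall, ncard_isPeriodic hT, hF, Nat.cast_pow]
  have hfin : all.Finite := finite_isPeriodic hT
  have hsplit : (all.ncard : ℝ) ≤ good.ncard + bad.ncard := by
    have hsub : all ⊆ good ∪ bad := by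
      intro s hs
      by_cases h : R < (kErrorLinearComplexity T k s : ℝ)
      · exact Or.inl ⟨hs, h⟩
      · exact Or.inr ⟨hs, Nat.le_floor (not_lt.1 h)⟩
    exact_mod_cast (Set.ncard_le_ncard hsub
      (hfin.subset (Set.union_subset (fun s hs => hs.1) (fun s hs => hs.1)))).trans
      (Set.ncard_union_le _ _)
  have hB : ({f : (∀ i, Fin (T i)) → F | {m | f m ≠ 0}.ncard ≤ k}.ncard : ℝ) ≤
      (q : ℝ) ^ (ε / 2 * N) := by
    have h1 := card_hammingBall_le (ι := ∀ i, Fin (T i)) (F := F) k hz0 hz1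
    rw [Fintype.card_pi, hF] at h1
    simp only [Fintype.card_fin] at h1
    exact le_of_mul_le_mul_right (h1.trans (hball N k hk)) (pow_pos hz0 k)
  have hbad : (bad.ncard : ℝ) < ε₂ * (q : ℝ) ^ N := by
    have h1 : (bad.ncard : ℝ) ≤ ((n * (K + 1)) ^ (K + 1) * q ^ ((n - 1) * K ^ 2 + 2 * K) : ℕ) *
        (q : ℝ) ^ (ε / 2 * N) := by
      refine (Nat.cast_le.2 (ncard_kErrorLinearComplexity_le hT k K)).trans ?_
      rw [Nat.cast_mul]
      refine mul_le_mul ?_ hB (Nat.cast_nonneg _) (Nat.cast_nonneg _)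
      exact_mod_cast hF ▸ ncard_linearComplexity_le (F := F) (by omega) hT K
    have h2 : (q : ℝ) ^ ((n - 1) * K ^ 2) ≤ (q : ℝ) ^ ((1 - ε) * N) := by
      rw [← Real.rpow_natCast]
      refine Real.rpow_le_rpow_of_exponent_le hqR.le ?_
      rw [Nat.cast_mul, Nat.cast_sub (by omega), Nat.cast_one, Nat.cast_pow]
      exact hK2
    have hqpos : (0 : ℝ) < q := by linarith
    calc (bad.ncard : ℝ) ≤ _ := h1
      _ = (((n : ℝ) * (K + 1)) ^ (K + 1) * (q : ℝ) ^ (2 * K)) * (q : ℝ) ^ ((n - 1) * K ^ 2) *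
          (q : ℝ) ^ (ε / 2 * N) := by
        push_cast
        rw [pow_add]
        ring
      _ < (ε₂ * (q : ℝ) ^ (ε / 2 * N)) * (q : ℝ) ^ ((1 - ε) * N) * (q : ℝ) ^ (ε / 2 * N) := by
        refine mul_lt_mul_of_pos_right ?_ (Real.rpow_pos_of_pos hqpos _)
        exact mul_lt_mul hasym h2 (by positivity) (by positivity)
      _ = ε₂ * (q : ℝ) ^ N := by
        rw [mul_assoc ε₂, mul_assoc ε₂, ← Real.rpow_add hqpos, ← Real.rpow_add hqpos,
          ← Real.rpow_natCast]
        congr 2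
        ring
  have hpos : (0 : ℝ) < (q : ℝ) ^ N := pow_pos (by linarith) N
  change 1 - ε₂ < (good.ncard : ℝ) / (all.ncard : ℝ)
  rw [hallcard] at hsplit ⊢
  rw [lt_div_iff₀ hpos]
  linarith

end MultiSeq

theorem theorem4p4 (q : ℕ) (hq : IsPrimePow q) (ε₁ : ℝ) (hε₁ : 0 < ε₁) :
    ∃ ε₃ : ℝ, 0 < ε₃ ∧ ∀ n : ℕ, 2 ≤ n → ∀ ε₂ : ℝ, 0 < ε₂ →
      ∃ C : ℝ, ∀ (F : Type*) [Field F] [Fintype F], Fintype.card F = q →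
        ∀ T : Fin n → ℕ, (∀ i, 0 < T i) → C < ∏ i, (T i : ℝ) →
          ∀ k : ℕ, (k : ℝ) < ε₃ * ∏ i, (T i : ℝ) →
            1 - ε₂ < MultiSeq.periodicProb T (fun s : MultiSeq.Seq n F =>
              Real.sqrt ((1 - ε₁) * (∏ i, (T i : ℝ)) / ((n : ℝ) - 1)) <
                (MultiSeq.kErrorLinearComplexity T k s : ℝ)) := by
  -- Replacing `ε₁` by `min ε₁ 1` makes the radicand nonnegative and can only raise the threshold,
  -- so the event shrinks.
  obtain ⟨ε₃, hε₃, h⟩ := MultiSeq.exists_error_rate_of_le_one hq.one_lt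
    (lt_min hε₁ one_pos) (min_le_right ε₁ 1)
  refine ⟨ε₃, hε₃, fun n hn ε₂ hε₂ => ?_⟩
  obtain ⟨C, hC⟩ := h n hn ε₂ hε₂
  refine ⟨C, fun F _ _ hF T hT hCT k hk => (hC F hF T hT hCT k hk).trans_le ?_⟩
  have hn1 : (0 : ℝ) ≤ (n : ℝ) - 1 := by
    have : (2 : ℝ) ≤ n := by exact_mod_cast hn
    linarith
  refine div_le_div_of_nonneg_right (Nat.cast_le.2 (Set.ncard_le_ncard ?_ ?_)) (Nat.cast_nonneg _)
  · rintro s ⟨hs, hlt⟩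
    refine ⟨hs, lt_of_le_of_lt (Real.sqrt_le_sqrt ?_) hlt⟩
    gcongr
    exact min_le_left _ _
  · exact (MultiSeq.finite_isPeriodic hT).subset fun s hs => hs.1
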